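/- Fix integers $d, D, N, L_0$. For $D\times D$ complex matrices $A_0,\dots,A_{d-1}$ write $|\psi_A\rangle=\sum_{i_1,\dots,i_N=0}^{d-1}\operatorname{tr}(A_{i_1}\cdots A_{i_N})\,|i_1\cdots i_N\rangle$. The $A_i$ are in *translation-invariant (TI) canonical form* if they are block diagonal, $A_i=\bigoplus_j \lambda_j A_i^j$ with $0<\lambda_j\le 1$, where for each block $j$: $\sum_i A_i^jA_i^{j\dagger}=\mathbb 1$; $\sum_i A_i^{j\dagger}\Lambda^jA_i^j=\Lambda^j$ for a positive full-rank diagonal matrix $\Lambda^j$; and, up to scalar multiples, $\mathbb 1$ is the only fixed point of $X\mapsto\sum_iA_i^jXA_i^{j\dagger}$. An *OBC canonical representation* of a state $|\psi\rangle$ writes it, up to normalization, as $\sum A^{[1]}_{i_1}\cdots A^{[N]}_{i_N}|i_1\cdots i_N\rangle$ with $D_m\times D_{m+1}$ matrices $A_i^{[m]}$, $D_1=D_{N+1}=1$, such that $\sum_iA_i^{[m]}A_i^{[m]\dagger}=\mathbb 1$ and $\sum_iA_i^{[m]\dagger}\Lambda^{[m-1]}A_i^{[m]}=\Lambda^{[m]}$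 for $1\le m\le N$, where the $\Lambda^{[m]}$ are diagonal, positive, of full rank and of trace one. It is *unique* if any two such representations of $|\psi\rangle$ differ only by permutations and phases of the basis vectors at each bond. **Theorem (Uniqueness of the canonical form).** Let $B_0,\dots,B_{d-1}$ be $D\times D$ matrices in TI canonical form such that (i) condition C1 holds: the map $X\mapsto\sum_{i_1,\dots,i_{L_0}}\operatorname{tr}(XB_{i_1}\cdots B_{i_{L_0}})|i_1\cdots i_{L_0}\rangle$ is injective, i.e. the products $B_{i_1}\cdots B_{i_{L_0}}$ span all $D\times D$ matrices; (ii) the OBC canonical representation of $|\psi_B\rangle$ is unique; and (iii) $N>2L_0+D^4$. If $C_0,\dots,C_{d-1}$ are $D\times D$ matrices in TI canonical form with $|\psi_C\rangle=|\psi_B\rangle$, then there are a unitary matrix $U$ and a complex number $\omega$ with $\omega^N=1$ such that $$B_i=\omega\,U C_iU^\dagger\qquad\text{for every } i .$$ If moreover the matrix $\Lambda$ of the canonical form of $B$ has pairwise distinct diagonal entries, then $B_i=\omega\,C_i$ for every $i$ up to a permutation and phases of the basis: there are a permutation $\sigma$ of $\{1,\dots,D\}$ and complex numbers $\theta_a$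 of modulus one with $(B_i)_{ab}=\omega\,\theta_a\,(C_i)_{\sigma(a)\sigma(b)}\,\overline{\theta_b}$ for all $i,a,b$. -/

import Mathlib

open scoped Matrix ComplexConjugate

noncomputable section

namespace MPS

/-- The ordered product `A_{s 0} A_{s 1} ⋯ A_{s (L-1)}` of site-independent matrices. -/
def word {d D L : ℕ} (A : Fin d → Matrix (Fin D) (Fin D) ℂ) (s : Fin L → Fin d) :
    Matrix (Fin D) (Fin D) ℂ :=
  (List.ofFn fun k => A (s k)).prod

/-- The state on a ring of `N` sites given by the coefficients `tr (A_{s 0} ⋯ A_{s (N-1)})`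
in the product basis. -/
def tiState {d D : ℕ} (N : ℕ) (A : Fin d → Matrix (Fin D) (Fin D) ℂ) : (Fin N → Fin d) → ℂ :=
  fun s => (word A s).trace

/-- The map `Γ_L : X ↦ ∑ tr (X A_{s 0} ⋯ A_{s (L-1)}) |s⟩`. -/
def gamma {d D : ℕ} (L : ℕ) (A : Fin d → Matrix (Fin D) (Fin D) ℂ)
    (X : Matrix (Fin D) (Fin D) ℂ) : (Fin L → Fin d) → ℂ :=
  fun s => (X * word A s).trace

/-- Condition C1 at length `L`: the map `Γ_L` is injective. -/
def ConditionC1 {d D : ℕ} (L : ℕ) (A : Fin d → Matrix (Fin D) (Fin D) ℂ) : Prop :=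
  Function.Injective (gamma L A)

/-- The diagonal matrix with the given real diagonal. -/
def realDiag {n : ℕ} (v : Fin n → ℝ) : Matrix (Fin n) (Fin n) ℂ :=
  Matrix.diagonal fun a => (v a : ℂ)

/-- The matrices `A_i` are in translation-invariant canonical form: they are block diagonal with
(consecutive, nonempty) blocks `λ_j A_i^j`, `0 < λ_j ≤ 1`, such that `∑ A_i^j (A_i^j)† = 1`,
`∑ (A_i^j)† Λ^j A_i^j = Λ^j` for a positive full-rank diagonal `Λ^j`, and the identity is, up to
scalars, the only fixed point of `X ↦ ∑ A_i^j X (A_i^j)†`. -/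
structure TICanonicalForm {d D : ℕ} (A : Fin d → Matrix (Fin D) (Fin D) ℂ) where
  numBlocks : ℕ
  size : Fin numBlocks → ℕ
  size_pos : ∀ j, 0 < size j
  sum_size : ∑ j, size j = D
  lam : Fin numBlocks → ℝ
  lam_pos : ∀ j, 0 < lam j
  lam_le_one : ∀ j, lam j ≤ 1
  block : ∀ j, Fin d → Matrix (Fin (size j)) (Fin (size j)) ℂ
  Lam : ∀ j, Fin (size j) → ℝ
  decomposition : ∀ i, A i =
    Matrix.reindex (finSigmaFinEquiv.trans (finCongr sum_size))
      (finSigmaFinEquiv.trans (finCongr sum_size))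
      (Matrix.blockDiagonal' fun j => (lam j : ℂ) • block j i)
  unital : ∀ j, ∑ i, block j i * (block j i)ᴴ = 1
  Lam_pos : ∀ j a, 0 < Lam j a
  Lam_fixed : ∀ j, ∑ i, (block j i)ᴴ * realDiag (Lam j) * block j i = realDiag (Lam j)
  fixed_unique : ∀ j (X : Matrix (Fin (size j)) (Fin (size j)) ℂ),
    ∑ i, block j i * X * (block j i)ᴴ = X → ∃ c : ℂ, X = c • 1

/-- Matrices with open boundary conditions on `N` sites: bond dimensions `dim 0, …, dim N`
with `dim 0 = dim N = 1`, and for each site `m` matrices of size `dim m × dim (m+1)`. -/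
structure OBC (d N : ℕ) where
  dim : Fin (N + 1) → ℕ
  dim_first : dim 0 = 1
  dim_last : dim (Fin.last N) = 1
  mat : ∀ m : Fin N, Fin d → Matrix (Fin (dim m.castSucc)) (Fin (dim m.succ)) ℂ

/-- The product of the matrices of the sites to the left of the bond `m`. -/
def OBC.leftProd {d N : ℕ} (A : OBC d N) (s : Fin N → Fin d) (m : Fin (N + 1)) :
    Matrix (Fin (A.dim 0)) (Fin (A.dim m)) ℂ :=
  Fin.induction (motive := fun m => Matrix (Fin (A.dim 0)) (Fin (A.dim m)) ℂ)
    1 (fun k P => P * A.mat k (s k)) m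

/-- The coefficients of the state: the only entry of the `1 × 1` matrix
`A^{[1]}_{s 0} ⋯ A^{[N]}_{s (N-1)}`. -/
def OBC.state {d N : ℕ} (A : OBC d N) : (Fin N → Fin d) → ℂ :=
  fun s => A.leftProd s (Fin.last N) (Fin.cast A.dim_first.symm 0) (Fin.cast A.dim_last.symm 0)

/-- The canonical form with open boundary conditions. The matrix `Λ` of the bond `m` is diagonal,
positive and of full rank with trace one; so it is `1` at the two ends. -/
def OBC.IsCanonical {d N : ℕ} (A : OBC d N) : Prop :=
  (∀ m, ∑ i, A.mat m i * (A.mat m i)ᴴ = 1) ∧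
  ∃ Lam : ∀ m : Fin (N + 1), Fin (A.dim m) → ℝ,
    (∀ m a, 0 < Lam m a) ∧ (∀ m, ∑ a, Lam m a = 1) ∧
    ∀ m : Fin N, ∑ i, (A.mat m i)ᴴ * realDiag (Lam m.castSucc) * A.mat m i = realDiag (Lam m.succ)

/-- `A` is an OBC canonical representation of the state with coefficients `ψ`. The canonical form
describes normalized vectors, so a vector `ψ ≠ 0` is represented up to its norm. -/
def OBC.IsCanonicalRepOf {d N : ℕ} (A : OBC d N) (ψ : (Fin N → Fin d) → ℂ) : Prop :=
  A.IsCanonical ∧ ∃ c : ℝ, 0 < c ∧ ∀ s, ψ s = c * A.state s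

/-- Two families of OBC matrices agree up to a relabelling of the basis vectors at each bond and
up to phases of these vectors. -/
def OBC.AgreeUpToPermPhase {d N : ℕ} (A A' : OBC d N) : Prop :=
  ∃ (σ : ∀ m, Fin (A.dim m) ≃ Fin (A'.dim m)) (θ : ∀ m, Fin (A.dim m) → ℂ),
    (∀ m a, ‖θ m a‖ = 1) ∧
    ∀ (m : Fin N) (i : Fin d) (a : Fin (A.dim m.castSucc)) (b : Fin (A.dim m.succ)),
      A'.mat m i (σ m.castSucc a) (σ m.succ b) =
        conj (θ m.castSucc a) * A.mat m i a b * θ m.succ b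

/-- The OBC canonical representation of `ψ` is unique, up to permutations and phases
(that is, there is no freedom that comes from degenerate Schmidt coefficients). -/
def UniqueOBCCanonical {d N : ℕ} (ψ : (Fin N → Fin d) → ℂ) : Prop :=
  ∀ A A' : OBC d N, A.IsCanonicalRepOf ψ → A'.IsCanonicalRepOf ψ → A.AgreeUpToPermPhase A'

end MPS

end

/-! Write `w_B`, `w_C` for the products of the `B i`, `C i` along a word `w`. Since `∑ B i (B i)ᴴ`
is a nonzero scalar, spanning by words of length `L₀` persists at all greater lengths. Cut the ring
into arcs of lengths `n` and `N - n`, both at least `L₀`. Equality of states says that the trace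
pairings of the two arcs agree for `B` and `C`. Nondegeneracy of the pairing makes the words of `C`
span too, and makes `w_B ↦ w_C` on words of length `n` a well-defined linear map `φ_n` of matrices.

These maps satisfy `φ_{n+1}(X B_i) = φ_n(X) C_i` and the same on the left. They live in a space of
dimension `D ^ 4`, and the slack in `N` provides `D ^ 4 + 1` consecutive ones, hence a linear
relation. A root `x` of a relation of minimal degree turns the recurrence into one map `Y ≠ 0` with
`x Y(X B_i) = Y(X) C_i` and `x Y(B_i X) = C_i Y(X)` (`exists_smul_eq_of_recurrence`). Then `Y 1` is
a nonzero scalar, `Y` divided by it is an algebra homomorphism, and Skolem–Noether gives `C_i = x P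
B_i P⁻¹`.

Condition C1 leaves one block in each canonical form. Uniqueness of the fixed point makes `P` a
multiple of a unitary. Comparing traces of words of length `N` shows that `x⁻¹` is an `N`-th root of
unity. If `Λ` is nondegenerate, the unitary intertwines two diagonal matrices, one with simple
spectrum, and is therefore monomial. -/

/-! ### Linear algebra: factorization and shift recurrences -/

section LinearAlgebra

/-- A linear map whose kernel contains the kernel of `f` factors through `f`. -/
theorem LinearMap.exists_comp_eq_of_ker_le {K V W W' : Type*} [Field K] [AddCommGroup V]
    [Module K V] [AddCommGroup W] [Module K W] [AddCommGroup W'] [Module K W']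
    (f : V →ₗ[K] W) (g : V →ₗ[K] W') (h : LinearMap.ker f ≤ LinearMap.ker g) :
    ∃ χ : W →ₗ[K] W', ∀ v, χ (f v) = g v := by
  obtain ⟨r, hr⟩ := f.rangeRestrict.exists_rightInverse_of_surjective f.range_rangeRestrict
  obtain ⟨χ, hχ⟩ := (g ∘ₗ r).exists_extend
  refine ⟨χ, fun v => ?_⟩
  have h1 := LinearMap.congr_fun hχ (f.rangeRestrict v)
  have h2 : f.rangeRestrict (r (f.rangeRestrict v)) = f.rangeRestrict v :=
    LinearMap.congr_fun hr _
  have h3 : r (f.rangeRestrict v) - v ∈ LinearMap.ker f := by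
    have := congrArg Subtype.val h2
    simpa [sub_eq_zero] using this
  have h4 := h h3
  rw [LinearMap.mem_ker, map_sub, sub_eq_zero] at h4
  simpa [h4] using h1

open Polynomial in
/-- If `T y_{k+1} = S y_k` along a sequence in a space of dimension `K`, then some nonzero `Y`
satisfies `x • T Y = S Y` for a nonzero scalar `x`. -/
theorem exists_smul_eq_of_recurrence {V W ι : Type*} [AddCommGroup V] [Module ℂ V]
    [FiniteDimensional ℂ V] [AddCommGroup W] [Module ℂ W] (T S : ι → V →ₗ[ℂ] W) (y : ℕ → V)
    (h0 : y 0 ≠ 0)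
    (hTS : ∀ i k, k < Module.finrank ℂ V → T i (y (k + 1)) = S i (y k))
    (hS : ∀ v, (∀ i, S i v = 0) → v = 0) :
    ∃ (v : V) (x : ℂ), v ≠ 0 ∧ x ≠ 0 ∧ ∀ i, x • T i v = S i v := by
  classical
  set K := Module.finrank ℂ V with hK
  -- Sending `X ^ k` to `y k` turns the shift of the sequence into multiplication by `X`.
  let ev : ℂ[X] →ₗ[ℂ] V := Polynomial.lsum fun k => LinearMap.toSpanSingleton ℂ V (y k)
  have hmon (k : ℕ) (a : ℂ) : ev (monomial k a) = a • y k := by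
    simp [ev, Polynomial.lsum, Polynomial.sum_monomial_index]
  have hrec (q : ℂ[X]) (hq : q.natDegree < K) (i : ι) : T i (ev (X * q)) = S i (ev q) := by
    rw [q.as_sum_range' K hq, Finset.mul_sum, map_sum, map_sum, map_sum, map_sum]
    refine Finset.sum_congr rfl fun k hk => ?_
    rw [X_mul_monomial, hmon, hmon, map_smul, map_smul, hTS i k (Finset.mem_range.1 hk)]
  -- The bound by `K` keeps the relation in the range where the recurrence holds: after a linear
  -- factor is split off, the degree is below `K`.
  have hex : ∃ n, ∃ p : ℂ[X], p ≠ 0 ∧ p.natDegree = n ∧ ev p = 0 ∧ p.natDegree ≤ K := by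
    have hdep : ¬ LinearIndependent ℂ fun k : Fin (K + 1) => y k := fun hli => by
      have := hli.fintype_card_le_finrank
      simp [← hK] at this
    obtain ⟨g, hg, i, hi⟩ := Fintype.not_linearIndependent_iff.1 hdep
    let p : ℂ[X] := ∑ k : Fin (K + 1), monomial (k : ℕ) (g k)
    have hc : p.coeff i = g i := by
      simp only [p, finsetSum_coeff, coeff_monomial, Fin.val_inj]
      simp
    refine ⟨_, p, fun h => hi (by rw [← hc, h, coeff_zero]), rfl, ?_, ?_⟩
    · simp only [p, map_sum, hmon, hg]
    · exact natDegree_sum_le_of_forall_le _ _ fun k _ =>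
        (natDegree_monomial_le _).trans (Nat.lt_succ_iff.1 k.2)
  obtain ⟨p, hp0, hpn, hpe, hpK⟩ := Nat.find_spec hex
  have hmin (q : ℂ[X]) (hq0 : q ≠ 0) (hq : q.natDegree < p.natDegree) : ev q ≠ 0 := fun h =>
    Nat.find_min hex (hpn ▸ hq) ⟨q, hq0, rfl, h, hq.le.trans hpK⟩
  have hdeg : p.degree ≠ 0 := fun h => by
    rw [eq_C_of_degree_eq_zero h, ← monomial_zero_left, hmon] at hpe
    rcases smul_eq_zero.1 hpe with h' | h'
    · exact hp0 (by rw [eq_C_of_degree_eq_zero h, h', C_0])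
    · exact h0 h'
  obtain ⟨x, hx⟩ := IsAlgClosed.exists_root p hdeg
  obtain ⟨q, rfl⟩ := dvd_iff_isRoot.2 hx
  have hq0 : q ≠ 0 := right_ne_zero_of_mul hp0
  have hnd : ((X - C x) * q).natDegree = q.natDegree + 1 := by
    rw [natDegree_mul (X_sub_C_ne_zero x) hq0, natDegree_X_sub_C, add_comm]
  -- With `p = (X - x) q`, minimality gives `ev q ≠ 0`, while `ev p = 0` makes `ev q` an eigenvector
  -- of the shift.
  have hv : ev q ≠ 0 := hmin q hq0 (by omega)
  have hxv : ev (X * q) = x • ev q := by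
    rw [sub_mul, map_sub, sub_eq_zero, C_mul', map_smul] at hpe
    exact hpe
  have key (i : ι) : x • T i (ev q) = S i (ev q) := by
    rw [← hrec q (by omega) i, hxv, map_smul]
  refine ⟨ev q, x, hv, fun h => hv (hS _ fun i => ?_), key⟩
  rw [← key i, h, zero_smul]

end LinearAlgebra

/-! ### The trace pairing and Skolem–Noether -/

namespace Matrix

variable {n : Type*} [Fintype n] [DecidableEq n]

theorem exists_trace_mul_eq {R : Type*} [CommRing R] (f : Matrix n n R →ₗ[R] R) :
    ∃ X : Matrix n n R, ∀ Y, f Y = (X * Y).trace := by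
  refine ⟨of fun i j => f (single j i 1), fun Y => ?_⟩
  conv_lhs => rw [matrix_eq_sum_single Y]
  simp only [map_sum, trace, diag, mul_apply, of_apply]
  rw [Finset.sum_comm]
  refine Finset.sum_congr rfl fun i _ => Finset.sum_congr rfl fun j _ => ?_
  have : single j i (Y j i) = Y j i • single j i (1 : R) := by simp [smul_single]
  rw [this, map_smul, smul_eq_mul, mul_comm]

theorem eq_zero_of_trace_mul_span_right {K ι : Type*} [Field K] {u : ι → Matrix n n K}
    (hu : Submodule.span K (Set.range u) = ⊤) {X : Matrix n n K}
    (h : ∀ i, (X * u i).trace = 0) : X = 0 := by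
  have h1 : traceLinearMap n K K ∘ₗ LinearMap.mulLeft K X = 0 :=
    LinearMap.ext_on_range hu fun i => by simpa using h i
  refine ext_iff_trace_mul_right.2 fun Y => ?_
  simpa using LinearMap.congr_fun h1 Y

/-- If two pairs of families have the same traces of products, then linear relations of one family
carry over to the other one. -/
theorem exists_linearMap_of_trace_mul_eq {K ι κ : Type*} [Field K] {u v : ι → Matrix n n K}
    {u' v' : κ → Matrix n n K} (h : ∀ i j, (u i * u' j).trace = (v i * v' j).trace)
    (hv' : Submodule.span K (Set.range v') = ⊤) :
    ∃ φ : Matrix n n K →ₗ[K] Matrix n n K, ∀ i, φ (u i) = v i := by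
  obtain ⟨φ, hφ⟩ := LinearMap.exists_comp_eq_of_ker_le (Finsupp.linearCombination K u)
    (Finsupp.linearCombination K v) fun c hc => by
      rw [LinearMap.mem_ker] at hc ⊢
      refine eq_zero_of_trace_mul_span_right hv' fun j => ?_
      have : (Finsupp.linearCombination K u c * u' j).trace = 0 := by rw [hc]; simp
      rw [← this]
      simp only [Finsupp.linearCombination_apply, Finsupp.sum, Finset.sum_mul, trace_sum,
        smul_mul_assoc, trace_smul, h]
  exact ⟨φ, fun i => by simpa using hφ (Finsupp.single i 1)⟩

/-- Linear relations among the `v i` also hold among the `u i`, so a linear map carries `v` to `u`;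
its image of the span of `v` is everything, and dimensions agree. -/
theorem span_range_eq_top_of_trace_mul_eq {K ι κ : Type*} [Field K] {u v : ι → Matrix n n K}
    {u' v' : κ → Matrix n n K} (h : ∀ i j, (u i * u' j).trace = (v i * v' j).trace)
    (hu : Submodule.span K (Set.range u) = ⊤) (hu' : Submodule.span K (Set.range u') = ⊤) :
    Submodule.span K (Set.range v) = ⊤ := by
  obtain ⟨χ, hχ⟩ := exists_linearMap_of_trace_mul_eq (fun i j => (h i j).symm) hu'
  have hmap : (Submodule.span K (Set.range v)).map χ = ⊤ := by
    rw [Submodule.map_span, ← Set.range_comp, ← hu]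
    congr 2
    exact funext hχ
  refine Submodule.eq_top_of_finrank_eq (le_antisymm (Submodule.finrank_le _) ?_)
  rw [← finrank_top K (Matrix n n K), ← hmap]
  exact Submodule.finrank_map_le _ _

/-- Skolem–Noether for matrix algebras. -/
theorem exists_conj_of_algHom {K : Type*} [Field K] [Nonempty n]
    (θ : Matrix n n K →ₐ[K] Matrix n n K) :
    ∃ P Q : Matrix n n K, P * Q = 1 ∧ Q * P = 1 ∧ ∀ X, θ X = P * X * Q := by
  have hinj : Function.Injective θ := θ.toRingHom.injective
  have hbij : Function.Bijective θ :=
    ⟨hinj, (LinearMap.injective_iff_surjective (f := θ.toLinearMap)).1 hinj⟩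
  let e := (toLinAlgEquiv' (R := K) (n := n)).symm.trans
    ((AlgEquiv.ofBijective θ hbij).trans toLinAlgEquiv')
  obtain ⟨t, ht⟩ := e.eq_linearEquivConjAlgEquiv
  refine ⟨LinearMap.toMatrix' t.toLinearMap, LinearMap.toMatrix' t.symm.toLinearMap, ?_, ?_,
    fun X => ?_⟩
  · rw [← LinearMap.toMatrix'_comp]; simp
  · rw [← LinearMap.toMatrix'_comp]; simp
  · have h1 : e (toLin' X) = toLin' (θ X) := by
      simp only [e, AlgEquiv.trans_apply]
      have : (toLinAlgEquiv' (R := K) (n := n)).symm (toLin' X) = X :=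
        LinearMap.toMatrix'_toLin' X
      rw [this]; rfl
    have h2 : toLin' (θ X) = t.toLinearMap ∘ₗ toLin' X ∘ₗ t.symm.toLinearMap := by
      rw [← h1, ht]; rfl
    rw [← LinearMap.toMatrix'_toLin' (θ X), h2, LinearMap.toMatrix'_comp, LinearMap.toMatrix'_comp,
      LinearMap.toMatrix'_toLin', Matrix.mul_assoc]

end Matrix

/-! ### Spanning words and similarity from equality of states -/

namespace MPS

variable {d D : ℕ}

/-- The ordered product of the matrices along a list of indices. -/
def wordProd (A : Fin d → Matrix (Fin D) (Fin D) ℂ) (l : List (Fin d)) :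
    Matrix (Fin D) (Fin D) ℂ :=
  (l.map A).prod

theorem word_eq_wordProd {L : ℕ} (A : Fin d → Matrix (Fin D) (Fin D) ℂ) (s : Fin L → Fin d) :
    word A s = wordProd A (List.ofFn s) := by
  rw [word, wordProd, List.map_ofFn]
  rfl

theorem wordProd_append (A : Fin d → Matrix (Fin D) (Fin D) ℂ) (l l' : List (Fin d)) :
    wordProd A (l ++ l') = wordProd A l * wordProd A l' := by
  simp [wordProd]

theorem wordProd_cons (A : Fin d → Matrix (Fin D) (Fin D) ℂ) (i : Fin d) (l : List (Fin d)) :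
    wordProd A (i :: l) = A i * wordProd A l := by
  simp [wordProd]

theorem wordProd_concat (A : Fin d → Matrix (Fin D) (Fin D) ℂ) (l : List (Fin d)) (i : Fin d) :
    wordProd A (l ++ [i]) = wordProd A l * A i := by
  simp [wordProd]

/-- The products of length `n` span all matrices. -/
def WordsSpan (A : Fin d → Matrix (Fin D) (Fin D) ℂ) (n : ℕ) : Prop :=
  Submodule.span ℂ (Set.range fun l : {l : List (Fin d) // l.length = n} => wordProd A l) = ⊤

theorem WordsSpan.conditionC1 {A : Fin d → Matrix (Fin D) (Fin D) ℂ} {n : ℕ}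
    (h : WordsSpan A n) : ConditionC1 n A := by
  intro X Y hXY
  rw [← sub_eq_zero]
  refine Matrix.eq_zero_of_trace_mul_span_right h fun l => ?_
  obtain ⟨l, rfl⟩ := l
  have := congrFun hXY l.get
  simp only [gamma, word_eq_wordProd, List.ofFn_get] at this
  rw [sub_mul, Matrix.trace_sub, this, sub_self]

/-- A functional that kills all words has the form `Y ↦ tr (X Y)`, and C1 forces `X = 0`. -/
theorem ConditionC1.wordsSpan {A : Fin d → Matrix (Fin D) (Fin D) ℂ} {n : ℕ}
    (h : ConditionC1 n A) : WordsSpan A n := by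
  by_contra hne
  obtain ⟨f, hf0, hf⟩ := Submodule.exists_le_ker_of_lt_top _ (lt_top_iff_ne_top.2 hne)
  obtain ⟨X, hX⟩ := Matrix.exists_trace_mul_eq f
  have hX0 : X = 0 := h <| funext fun s => by
    have : f (wordProd A (List.ofFn s)) = 0 :=
      hf (Submodule.subset_span ⟨⟨List.ofFn s, List.length_ofFn⟩, rfl⟩)
    simp only [gamma, word_eq_wordProd]
    rw [← hX, this]
    simp
  exact hf0 (LinearMap.ext fun Y => by rw [hX, hX0]; simp)

/-- The normalization writes any `X` as `c⁻¹ ∑ A_i (A_iᴴ X)`, and each `A_iᴴ X` is a combination of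
words of length `n`. -/
theorem WordsSpan.succ {A : Fin d → Matrix (Fin D) (Fin D) ℂ} {n : ℕ} (h : WordsSpan A n)
    {c : ℂ} (hc : c ≠ 0) (hA : ∑ i, A i * (A i)ᴴ = c • 1) : WordsSpan A (n + 1) := by
  rw [WordsSpan, Submodule.eq_top_iff']
  have hmul (i : Fin d) (Z : Matrix (Fin D) (Fin D) ℂ) : A i * Z ∈ Submodule.span ℂ
      (Set.range fun l : {l : List (Fin d) // l.length = n + 1} => wordProd A l) := by
    have hZ : Z ∈ Submodule.span ℂ
        (Set.range fun l : {l : List (Fin d) // l.length = n} => wordProd A l) := by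
      rw [h]; trivial
    induction hZ using Submodule.span_induction with
    | mem x hx =>
      obtain ⟨⟨l, hl⟩, rfl⟩ := hx
      exact Submodule.subset_span ⟨⟨i :: l, by simp [hl]⟩, wordProd_cons A i l⟩
    | zero => simp
    | add x y _ _ hx hy => rw [mul_add]; exact add_mem hx hy
    | smul a x _ hx => rw [mul_smul_comm]; exact Submodule.smul_mem _ _ hx
  intro X
  have hX : X = c⁻¹ • ∑ i, A i * ((A i)ᴴ * X) := by
    simp_rw [← Matrix.mul_assoc]
    rw [← Finset.sum_mul, hA, smul_mul_assoc, one_mul, inv_smul_smul₀ hc]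
  rw [hX]
  exact Submodule.smul_mem _ _ (Submodule.sum_mem _ fun i _ => hmul i _)

theorem WordsSpan.mono {A : Fin d → Matrix (Fin D) (Fin D) ℂ} {m n : ℕ} (h : WordsSpan A m)
    {c : ℂ} (hc : c ≠ 0) (hA : ∑ i, A i * (A i)ᴴ = c • 1) (hmn : m ≤ n) : WordsSpan A n := by
  induction n, hmn using Nat.le_induction with
  | base => exact h
  | succ n _ ih => exact ih.succ hc hA

theorem trace_wordProd_eq_of_tiState_eq {N : ℕ} {B C : Fin d → Matrix (Fin D) (Fin D) ℂ}
    (h : tiState N B = tiState N C) {l : List (Fin d)} (hl : l.length = N) :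
    (wordProd B l).trace = (wordProd C l).trace := by
  subst hl
  have := congrFun h l.get
  simpa only [tiState, word_eq_wordProd, List.ofFn_get] using this

/-- The rank across a cut shows that the spanning property depends only on the state. -/
theorem WordsSpan.of_tiState_eq {N n : ℕ} {B C : Fin d → Matrix (Fin D) (Fin D) ℂ}
    (h : tiState N B = tiState N C) (hn : n ≤ N) (h1 : WordsSpan B n) (h2 : WordsSpan B (N - n)) :
    WordsSpan C n := by
  refine Matrix.span_range_eq_top_of_trace_mul_eq (fun l l' => ?_) h1 h2
    (v' := fun l : {l : List (Fin d) // l.length = N - n} => wordProd C l)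
  rw [← wordProd_append, ← wordProd_append]
  refine trace_wordProd_eq_of_tiState_eq h ?_
  rw [List.length_append, l.2, l'.2]
  omega

theorem exists_linearMap_wordProd {N n : ℕ} {B C : Fin d → Matrix (Fin D) (Fin D) ℂ}
    (h : tiState N B = tiState N C) (hn : n ≤ N) (h2 : WordsSpan C (N - n)) :
    ∃ φ : Matrix (Fin D) (Fin D) ℂ →ₗ[ℂ] Matrix (Fin D) (Fin D) ℂ,
      ∀ l : List (Fin d), l.length = n → φ (wordProd B l) = wordProd C l := by
  obtain ⟨φ, hφ⟩ := Matrix.exists_linearMap_of_trace_mul_eq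
    (u := fun l : {l : List (Fin d) // l.length = n} => wordProd B l)
    (v := fun l : {l : List (Fin d) // l.length = n} => wordProd C l)
    (u' := fun l : {l : List (Fin d) // l.length = N - n} => wordProd B l) (fun l l' => by
      rw [← wordProd_append, ← wordProd_append]
      refine trace_wordProd_eq_of_tiState_eq h ?_
      rw [List.length_append, l.2, l'.2]
      omega) h2
  exact ⟨φ, fun l hl => hφ ⟨l, hl⟩⟩

/-- A nonzero linear map that intertwines left and right multiplication by `x • B i` and by `C i`
yields a similarity. -/
theorem exists_conj_of_intertwining [NeZero D] {L : ℕ} {B C : Fin d → Matrix (Fin D) (Fin D) ℂ}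
    (hB : WordsSpan B L) (hC : WordsSpan C L)
    {Y : Matrix (Fin D) (Fin D) ℂ →ₗ[ℂ] Matrix (Fin D) (Fin D) ℂ} {x : ℂ} (hY : Y ≠ 0) (hx : x ≠ 0)
    (hr : ∀ i X, x • Y (X * B i) = Y X * C i) (hl : ∀ i X, x • Y (B i * X) = C i * Y X) :
    ∃ P Q : Matrix (Fin D) (Fin D) ℂ, P * Q = 1 ∧ Q * P = 1 ∧ ∀ i, C i = x • (P * B i * Q) := by
  have hwr (l : List (Fin d)) : ∀ X, x ^ l.length • Y (X * wordProd B l) = Y X * wordProd C l := by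
    induction l with
    | nil => intro X; simp [wordProd]
    | cons i l ih =>
      intro X
      rw [wordProd_cons, wordProd_cons, ← mul_assoc, ← mul_assoc, ← hr, smul_mul_assoc, ← ih,
        List.length_cons, pow_succ', mul_smul]
  have hwl (l : List (Fin d)) : ∀ X, x ^ l.length • Y (wordProd B l * X) = wordProd C l * Y X := by
    induction l with
    | nil => intro X; simp [wordProd]
    | cons i l ih =>
      intro X
      rw [wordProd_cons, wordProd_cons, mul_assoc, mul_assoc, ← ih, mul_smul_comm, ← hl,
        List.length_cons, pow_succ, mul_smul]
  -- Moving a word through `Y` from either side shows that `Y 1` commutes with all words of `C`,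
  -- which span.
  have hcomm (Z : Matrix (Fin D) (Fin D) ℂ) : Z * Y 1 = Y 1 * Z := by
    have : LinearMap.mulRight ℂ (Y 1) = LinearMap.mulLeft ℂ (Y 1) :=
      LinearMap.ext_on_range hC fun l => by
        simp only [LinearMap.mulRight_apply, LinearMap.mulLeft_apply]
        rw [← hwr, ← hwl, one_mul, mul_one]
    exact LinearMap.congr_fun this Z
  obtain ⟨g, hg⟩ : ∃ g : ℂ, Y 1 = g • 1 := by
    have := Matrix.mem_range_scalar_of_commute_single (M := Y 1) fun i j _ => hcomm _
    obtain ⟨g, hg⟩ := this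
    exact ⟨g, by rw [← hg, Matrix.smul_one_eq_diagonal]; rfl⟩
  have hg0 : g ≠ 0 := by
    rintro rfl
    have h1 (l : {l : List (Fin d) // l.length = L}) : x ^ L • Y (wordProd B l) = 0 := by
      have := hwr l 1
      rwa [hg, zero_smul, zero_mul, one_mul, l.2] at this
    exact hY (LinearMap.ext_on_range hB fun l => by
      simpa [hx] using h1 l)
  have hmul (X Z : Matrix (Fin D) (Fin D) ℂ) : g • Y (X * Z) = Y X * Y Z := by
    have : g • (Y ∘ₗ LinearMap.mulLeft ℂ X) = LinearMap.mulLeft ℂ (Y X) ∘ₗ Y :=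
      LinearMap.ext_on_range hB fun l => by
        have h1 := hwr l X
        have h2 := hwr l 1
        rw [one_mul, hg, smul_mul_assoc, one_mul] at h2
        refine smul_right_injective _ (pow_ne_zero (l : List (Fin d)).length hx) ?_
        simp only [LinearMap.smul_apply, LinearMap.comp_apply, LinearMap.mulLeft_apply]
        rw [smul_comm, h1, ← mul_smul_comm _ (Y X), ← h2, mul_smul_comm]
    exact LinearMap.congr_fun this Z
  let θ : Matrix (Fin D) (Fin D) ℂ →ₐ[ℂ] Matrix (Fin D) (Fin D) ℂ :=
    AlgHom.ofLinearMap (g⁻¹ • Y) (by rw [LinearMap.smul_apply, hg, inv_smul_smul₀ hg0])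
      fun X Z => by
        simp only [LinearMap.smul_apply]
        rw [smul_mul_smul_comm, ← hmul, mul_smul, inv_smul_smul₀ hg0]
  obtain ⟨P, Q, hPQ, hQP, hθ⟩ := Matrix.exists_conj_of_algHom θ
  refine ⟨P, Q, hPQ, hQP, fun i => ?_⟩
  have h1 : g⁻¹ • Y (B i) = P * B i * Q := hθ (B i)
  have h2 := hr i 1
  rw [one_mul, hg, smul_mul_assoc, one_mul] at h2
  rw [← h1, smul_comm, h2, inv_smul_smul₀ hg0]

/-- Two families whose words of length `L` and `N - L` span, and which generate the same state on
`N ≥ 2 L + D ^ 4` sites, are similar up to a scalar. -/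
theorem exists_conj_of_tiState_eq [NeZero D] {N L : ℕ} {B C : Fin d → Matrix (Fin D) (Fin D) ℂ}
    (hψ : tiState N B = tiState N C) (hN : 2 * L + D ^ 4 ≤ N)
    (hB : ∀ n, L ≤ n → WordsSpan B n)
    {c : ℂ} (hc : c ≠ 0) (hunit : ∑ i, C i * (C i)ᴴ = c • 1) :
    ∃ P Q : Matrix (Fin D) (Fin D) ℂ, P * Q = 1 ∧ Q * P = 1 ∧
      ∃ x : ℂ, x ≠ 0 ∧ ∀ i, C i = x • (P * B i * Q) := by
  have hC : ∀ n, L ≤ n → n + L ≤ N → WordsSpan C n := fun n h1 h2 =>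
    WordsSpan.of_tiState_eq hψ (by omega) (hB n h1) (hB _ (by omega))
  have hφ : ∀ k, k ≤ D ^ 4 → ∃ φ : Matrix (Fin D) (Fin D) ℂ →ₗ[ℂ] Matrix (Fin D) (Fin D) ℂ,
      ∀ l : List (Fin d), l.length = L + k → φ (wordProd B l) = wordProd C l := fun k hk =>
    exists_linearMap_wordProd hψ (by omega) (hC _ (by omega) (by omega))
  choose! φ hφ using hφ
  have hrank : Module.finrank ℂ (Matrix (Fin D) (Fin D) ℂ →ₗ[ℂ] Matrix (Fin D) (Fin D) ℂ)
      = D ^ 4 := by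
    rw [Module.finrank_linearMap, Module.finrank_matrix]
    simp
    ring
  have hCL := hC L le_rfl (by omega)
  have hφ0 : φ 0 ≠ 0 := fun h => by
    have : (LinearMap.id : Matrix (Fin D) (Fin D) ℂ →ₗ[ℂ] Matrix (Fin D) (Fin D) ℂ) = 0 :=
      LinearMap.ext_on_range hCL fun l => by
        have := hφ 0 (Nat.zero_le _) l (by rw [l.2, add_zero])
        rw [h] at this
        simpa using this.symm
    exact one_ne_zero (LinearMap.congr_fun this (1 : Matrix (Fin D) (Fin D) ℂ))
  obtain ⟨Y, x, hY, hx, h⟩ := exists_smul_eq_of_recurrence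
    (V := Matrix (Fin D) (Fin D) ℂ →ₗ[ℂ] Matrix (Fin D) (Fin D) ℂ) (ι := Fin d ⊕ Fin d)
    -- `T` precomposes with multiplication by `B i`, `S` postcomposes with multiplication by `C i`;
    -- the two summands of the index type are right and left multiplication.
    (Sum.elim (fun i => LinearMap.lcomp ℂ _ (LinearMap.mulRight ℂ (B i)))
      (fun i => LinearMap.lcomp ℂ _ (LinearMap.mulLeft ℂ (B i))))
    (Sum.elim (fun i => LinearMap.compRight ℂ (LinearMap.mulRight ℂ (C i)))
      (fun i => LinearMap.compRight ℂ (LinearMap.mulLeft ℂ (C i))))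
    φ hφ0 (by
      intro i k hk
      rw [hrank] at hk
      rcases i with i | i
      · refine LinearMap.ext_on_range (hB (L + k) (by omega)) fun l => ?_
        have h1 := hφ (k + 1) (by omega) (l ++ [i]) (by simp [l.2]; omega)
        rw [wordProd_concat, wordProd_concat] at h1
        have h2 := hφ k hk.le l l.2
        simpa [LinearMap.compRight_apply, h2] using h1
      · refine LinearMap.ext_on_range (hB (L + k) (by omega)) fun l => ?_
        have h1 := hφ (k + 1) (by omega) (i :: l) (by simp [l.2]; omega)
        rw [wordProd_cons, wordProd_cons] at h1
        have h2 := hφ k hk.le l l.2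
        simpa [LinearMap.compRight_apply, h2] using h1) (by
      intro v hv
      refine LinearMap.ext fun X => ?_
      have h1 (i : Fin d) : v X * C i = 0 := by
        simpa using LinearMap.congr_fun (hv (Sum.inl i)) X
      have h2 : v X * ∑ i, C i * (C i)ᴴ = 0 := by
        rw [Finset.mul_sum]
        exact Finset.sum_eq_zero fun i _ => by rw [← mul_assoc, h1, zero_mul]
      rw [hunit, mul_smul_comm, mul_one] at h2
      simpa [hc] using h2)
  obtain ⟨P, Q, hPQ, hQP, hC'⟩ := exists_conj_of_intertwining (hB L le_rfl) hCL hY hx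
    (fun i X => by simpa using LinearMap.congr_fun (h (Sum.inl i)) X)
    (fun i X => by simpa using LinearMap.congr_fun (h (Sum.inr i)) X)
  exact ⟨P, Q, hPQ, hQP, x, hx, hC'⟩

end MPS

/-! ### Rigidity of a single canonical block -/

namespace MPS

/-- The transfer map and its dual for the trace pairing. -/
theorem trace_mul_transfer {d : ℕ} {n : Type*} [Fintype n] (b : Fin d → Matrix n n ℂ)
    (Z X : Matrix n n ℂ) :
    (Z * ∑ i, b i * X * (b i)ᴴ).trace = ((∑ i, (b i)ᴴ * Z * b i) * X).trace := by
  rw [Finset.mul_sum, Finset.sum_mul, Matrix.trace_sum, Matrix.trace_sum]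
  refine Finset.sum_congr rfl fun i _ => ?_
  rw [← Matrix.mul_assoc, Matrix.trace_mul_comm]
  simp only [Matrix.mul_assoc]

/-- A single block of the canonical form, on an arbitrary index type. -/
structure IsCanonicalBlock {d : ℕ} {n : Type*} [Fintype n] [DecidableEq n]
    (b : Fin d → Matrix n n ℂ) (Λ : n → ℝ) : Prop where
  unital : ∑ i, b i * (b i)ᴴ = 1
  pos : ∀ a, 0 < Λ a
  fixed : ∑ i, (b i)ᴴ * Matrix.diagonal (fun a => (Λ a : ℂ)) * b i =
    Matrix.diagonal (fun a => (Λ a : ℂ))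
  fixed_unique : ∀ X : Matrix n n ℂ, ∑ i, b i * X * (b i)ᴴ = X → ∃ c : ℂ, X = c • 1

namespace IsCanonicalBlock

section

open scoped ComplexOrder

variable {d : ℕ} {n : Type*} [Fintype n] [DecidableEq n]

theorem reindex {m : Type*} [Fintype m] [DecidableEq m] {b : Fin d → Matrix n n ℂ} {Λ : n → ℝ}
    (h : IsCanonicalBlock b Λ) (e : n ≃ m) :
    IsCanonicalBlock (fun i => Matrix.reindexAlgEquiv ℂ ℂ e (b i)) (Λ ∘ e.symm) := by
  have hstar (X : Matrix n n ℂ) : (Matrix.reindexAlgEquiv ℂ ℂ e X)ᴴ =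
      Matrix.reindexAlgEquiv ℂ ℂ e Xᴴ := rfl
  have hdiag : Matrix.diagonal (fun a => ((Λ ∘ e.symm) a : ℂ)) =
      Matrix.reindexAlgEquiv ℂ ℂ e (Matrix.diagonal fun a => (Λ a : ℂ)) := by
    simp [Matrix.coe_reindexAlgEquiv, Matrix.reindex_apply, Matrix.submatrix_diagonal_equiv,
      Function.comp_def]
  refine ⟨?_, fun a => h.pos _, ?_, fun X hX => ?_⟩
  · simp only [hstar, ← map_mul, ← map_sum, h.unital, map_one]
  · rw [hdiag]
    simp only [hstar, ← map_mul, ← map_sum, h.fixed]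
  · obtain ⟨X, rfl⟩ := (Matrix.reindexAlgEquiv ℂ ℂ e).surjective X
    simp only [hstar, ← map_mul, ← map_sum] at hX
    obtain ⟨c, rfl⟩ := h.fixed_unique X ((Matrix.reindexAlgEquiv ℂ ℂ e).injective hX)
    exact ⟨c, by simp only [map_smul, map_one]⟩

variable {b c : Fin d → Matrix n n ℂ} {Λ Λ' : n → ℝ}

theorem posDef_diagonal (h : IsCanonicalBlock b Λ) :
    (Matrix.diagonal fun a => (Λ a : ℂ)).PosDef :=
  Matrix.PosDef.diagonal fun a => by exact_mod_cast h.pos a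

theorem trace_ne_zero [Nonempty n] (h : IsCanonicalBlock b Λ) :
    (Matrix.diagonal fun a => (Λ a : ℂ)).trace ≠ 0 :=
  h.posDef_diagonal.trace_pos.ne'

/-- The fixed points of the dual of the transfer map are the multiples of `Λ`. -/
theorem dual_fixed_unique [Nonempty n] (h : IsCanonicalBlock b Λ) {Z : Matrix n n ℂ}
    (hZ : ∑ i, (b i)ᴴ * Z * b i = Z) :
    ∃ c : ℂ, Z = c • Matrix.diagonal fun a => (Λ a : ℂ) := by
  set R : Matrix n n ℂ := Matrix.diagonal fun a => (Λ a : ℂ) with hR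
  let E : Matrix n n ℂ →ₗ[ℂ] Matrix n n ℂ :=
    ∑ i, (LinearMap.mulRight ℂ (b i)ᴴ ∘ₗ LinearMap.mulLeft ℂ (b i)) - LinearMap.id
  have hE (X) : E X = ∑ i, b i * X * (b i)ᴴ - X := by simp [E]
  have hRfix : ∑ i, (b i)ᴴ * R * b i = R := h.fixed
  have hann {Y : Matrix n n ℂ} (hY : ∑ i, (b i)ᴴ * Y * b i = Y) (X) : (Y * E X).trace = 0 := by
    rw [hE, mul_sub, Matrix.trace_sub, trace_mul_transfer, hY, sub_self]
  have hker (X) (hX : E X = 0) : ∃ c : ℂ, X = c • 1 :=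
    h.fixed_unique X (by rwa [hE, sub_eq_zero] at hX)
  have htr := h.trace_ne_zero
  -- The kernel consists of scalars and `tr (R ·)` vanishes on the range but not at `1`, so the two
  -- are complementary. A functional vanishing on the range is then determined by its value at `1`.
  have htop : LinearMap.range E ⊔ LinearMap.ker E = ⊤ := by
    refine Submodule.eq_top_of_disjoint _ _ (LinearMap.finrank_range_add_finrank_ker E).ge ?_
    rw [Submodule.disjoint_def]
    rintro _ ⟨W, rfl⟩ hW
    obtain ⟨c, hc⟩ := hker _ hW
    have := hann hRfix W
    rw [hc, mul_smul_comm, mul_one, Matrix.trace_smul, smul_eq_zero] at this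
    rw [hc, this.resolve_right htr, zero_smul]
  refine ⟨Z.trace / R.trace, ?_⟩
  refine Matrix.ext_iff_trace_mul_right.2 fun Y => ?_
  have hY : Y ∈ LinearMap.range E ⊔ LinearMap.ker E := htop ▸ Submodule.mem_top
  obtain ⟨_, ⟨W, rfl⟩, K, hK, rfl⟩ := Submodule.mem_sup.1 hY
  obtain ⟨c, rfl⟩ := hker K hK
  simp only [mul_add, Matrix.trace_add, smul_mul_assoc, Matrix.trace_smul, hann hZ, hann hRfix,
    mul_smul_comm, mul_one, smul_eq_mul, zero_add]
  have htr' : R.trace ≠ 0 := htr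
  field_simp
  ring

/-- Similar canonical blocks are unitarily equivalent up to a phase. -/
theorem exists_unitary_conj [Nonempty n] (hb : IsCanonicalBlock b Λ) (hc : IsCanonicalBlock c Λ')
    {P Q : Matrix n n ℂ} (hPQ : P * Q = 1) (hQP : Q * P = 1) {κ : ℂ}
    (h : ∀ i, c i = κ • (P * b i * Q)) :
    ‖κ‖ = 1 ∧ ∃ V ∈ Matrix.unitaryGroup n ℂ, ∀ i, c i = κ • (V * b i * Vᴴ) := by
  have hQPs : Pᴴ * Qᴴ = 1 := by rw [← Matrix.conjTranspose_mul, hQP, Matrix.conjTranspose_one]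
  have hPQs : Qᴴ * Pᴴ = 1 := by rw [← Matrix.conjTranspose_mul, hPQ, Matrix.conjTranspose_one]
  -- This is unitality of `c` conjugated back by `Q`; pairing it with `Λ` below isolates `|κ|² = 1`.
  have hfix : (κ * star κ) • ∑ i, b i * (Q * Qᴴ) * (b i)ᴴ = Q * Qᴴ := by
    have h1 := hc.unital
    simp only [h, Matrix.conjTranspose_smul, Matrix.conjTranspose_mul, smul_mul_smul_comm] at h1
    calc (κ * star κ) • ∑ i, b i * (Q * Qᴴ) * (b i)ᴴ
        = ∑ i, Q * ((κ * star κ) • (P * b i * Q * (Qᴴ * ((b i)ᴴ * Pᴴ)))) * Qᴴ := by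
          rw [Finset.smul_sum]
          refine Finset.sum_congr rfl fun i _ => ?_
          rw [mul_smul_comm, smul_mul_assoc]
          congr 1
          calc b i * (Q * Qᴴ) * (b i)ᴴ
              = (Q * P) * (b i * (Q * Qᴴ) * (b i)ᴴ) * (Pᴴ * Qᴴ) := by
                rw [hQP, hQPs, one_mul, mul_one]
            _ = _ := by simp only [Matrix.mul_assoc]
      _ = Q * Qᴴ := by rw [← Finset.sum_mul, ← Finset.mul_sum, h1, mul_one]
  have hQpos : (Q * Qᴴ).PosDef := Matrix.PosDef.mul_conjTranspose_self Q
    (Function.LeftInverse.injective (g := fun v => v ᵥ* P) fun v => by simp [hQP])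
  have htr : 0 < (Matrix.diagonal (fun a => (Λ a : ℂ)) * (Q * Qᴴ)).trace := by
    rw [← Matrix.mul_assoc, Matrix.trace_mul_comm, ← Matrix.mul_assoc]
    refine (hb.posDef_diagonal.conjTranspose_mul_mul_same (B := Q) ?_).trace_pos
    exact Function.LeftInverse.injective (g := fun v => P *ᵥ v) fun v => by simp [hPQ]
  have hκ : κ * star κ = 1 := by
    have h1 := congrArg (fun X => (Matrix.diagonal (fun a => (Λ a : ℂ)) * X).trace) hfix
    simp only [mul_smul_comm, Matrix.trace_smul] at h1
    rw [trace_mul_transfer, hb.fixed, smul_eq_mul] at h1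
    exact mul_right_cancel₀ htr.ne' (h1.trans (one_mul _).symm)
  rw [hκ, one_smul] at hfix
  obtain ⟨q, hq⟩ := hb.fixed_unique _ hfix
  have hq0 : 0 < q := by
    have := hQpos.diag_pos (i := Classical.arbitrary n)
    simpa [hq] using this
  obtain ⟨r, rfl⟩ : ∃ r : ℝ, q = r := ⟨q.re, (Complex.ext rfl (by simpa using (Complex.lt_def.1 hq0).2.symm))⟩
  have hr : 0 < r := by exact_mod_cast hq0
  -- From `Q Qᴴ = r • 1` and `P = Q⁻¹`, the multiple `√r • P` is unitary.
  set t : ℝ := Real.sqrt r with ht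
  have ht0 : (t : ℂ) ≠ 0 := by exact_mod_cast (Real.sqrt_pos.2 hr).ne'
  have htt : (t : ℂ) * t = r := by exact_mod_cast Real.mul_self_sqrt hr.le
  have hP : (t : ℂ) • P = (t : ℂ)⁻¹ • Qᴴ := by
    have h1 : Qᴴ = (r : ℂ) • P := by
      calc Qᴴ = P * (Q * Qᴴ) := by rw [← Matrix.mul_assoc, hPQ, one_mul]
        _ = _ := by rw [hq, mul_smul_comm, mul_one]
    rw [h1, smul_smul, ← htt, inv_mul_cancel_left₀ ht0]
  have hV : ((t : ℂ) • P)ᴴ = (t : ℂ)⁻¹ • Q := by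
    rw [hP, Matrix.conjTranspose_smul, Matrix.conjTranspose_conjTranspose]
    simp
  refine ⟨?_, (t : ℂ) • P, ?_, fun i => ?_⟩
  · have h1 := congrArg norm hκ
    rw [norm_mul, norm_star, norm_one] at h1
    nlinarith [norm_nonneg κ]
  · rw [Matrix.mem_unitaryGroup_iff, Matrix.star_eq_conjTranspose, hV, smul_mul_smul_comm, hPQ,
      mul_inv_cancel₀ ht0, one_smul]
  · rw [hV, h, smul_mul_assoc, smul_mul_smul_comm, mul_inv_cancel₀ ht0, one_smul]

/-- If `Λ` is nondegenerate, a unitary equivalence of canonical blocks is a permutation of the basis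
vectors up to phases. -/
theorem exists_perm_of_unitary_conj [Nonempty n] (hb : IsCanonicalBlock b Λ)
    (hc : IsCanonicalBlock c Λ') (hΛ : Function.Injective Λ) {κ : ℂ} (hκ : ‖κ‖ = 1)
    {V : Matrix n n ℂ} (hV : V ∈ Matrix.unitaryGroup n ℂ) (h : ∀ i, c i = κ • (V * b i * Vᴴ)) :
    ∃ (σ : Equiv.Perm n) (θ : n → ℂ), (∀ a, ‖θ a‖ = 1) ∧
      ∀ (X : Matrix n n ℂ) (a e : n), (Vᴴ * X * V) a e = θ a * X (σ a) (σ e) * conj (θ e) := by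
  have hVV : V * Vᴴ = 1 := Matrix.mem_unitaryGroup_iff.1 hV
  have hVV' : Vᴴ * V = 1 := Matrix.mem_unitaryGroup_iff'.1 hV
  have hκ' : star κ * κ = 1 := by
    have := Complex.conj_mul' κ
    rw [hκ] at this
    simpa using this
  set R : Matrix n n ℂ := Matrix.diagonal fun a => (Λ a : ℂ) with hR
  set R' : Matrix n n ℂ := Matrix.diagonal fun a => (Λ' a : ℂ) with hR'
  -- Pulled back by `V`, the dual fixed point of `c` becomes one of `b`, hence a multiple of `R`. So
  -- `V` intertwines `R'` with `k R`, and distinct entries of `Λ` allow one nonzero entry per row.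
  have hfix : ∑ i, (b i)ᴴ * (Vᴴ * R' * V) * b i = Vᴴ * R' * V := by
    have h1 := hc.fixed
    rw [← hR'] at h1
    simp only [h, Matrix.conjTranspose_smul, Matrix.conjTranspose_mul, smul_mul_assoc,
      mul_smul_comm, smul_smul, Matrix.conjTranspose_conjTranspose] at h1
    conv_rhs => rw [← h1, Finset.mul_sum, Finset.sum_mul]
    refine Finset.sum_congr rfl fun i _ => ?_
    rw [mul_comm κ, hκ', one_smul]
    calc (b i)ᴴ * (Vᴴ * R' * V) * b i
        = (Vᴴ * V) * ((b i)ᴴ * (Vᴴ * R' * V) * b i) * (Vᴴ * V) := by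
          rw [hVV', one_mul, mul_one]
      _ = _ := by simp only [Matrix.mul_assoc]
  obtain ⟨k, hk⟩ := hb.dual_fixed_unique hfix
  have hint : R' * V = k • (V * R) := by
    calc R' * V = (V * Vᴴ) * R' * V := by rw [hVV, one_mul]
      _ = V * (Vᴴ * R' * V) := by simp only [Matrix.mul_assoc]
      _ = _ := by rw [hk, mul_smul_comm]
  have hent (a e : n) : (Λ' a : ℂ) * V a e = k * (V a e * Λ e) := by
    have := congrFun (congrFun hint a) e
    simpa [hR, hR'] using this
  have hk0 : k ≠ 0 := by
    rintro rfl
    have h1 : V = 0 := by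
      ext a e
      have := hent a e
      have h2 : (Λ' a : ℂ) ≠ 0 := by exact_mod_cast (hc.pos a).ne'
      simpa [h2] using this
    rw [h1, zero_mul] at hVV
    exact zero_ne_one hVV
  have huniq (a e e' : n) (he : V a e ≠ 0) (he' : V a e' ≠ 0) : e = e' := by
    have h1 : (Λ' a : ℂ) = k * Λ e := mul_right_cancel₀ he (by rw [hent]; ring)
    have h2 : (Λ' a : ℂ) = k * Λ e' := mul_right_cancel₀ he' (by rw [hent]; ring)
    exact hΛ (by exact_mod_cast mul_left_cancel₀ hk0 (h1.symm.trans h2))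
  have hrow (a : n) : ∃ e, V a e ≠ 0 := by
    by_contra! hz
    have := congrFun (congrFun hVV a) a
    simp [Matrix.mul_apply, hz] at this
  choose f hf using hrow
  have hfz (a e : n) (he : e ≠ f a) : V a e = 0 := by
    by_contra hne
    exact he (huniq a e (f a) hne (hf a))
  have hnorm (a : n) : V a (f a) * conj (V a (f a)) = 1 := by
    have := congrFun (congrFun hVV a) a
    rw [Matrix.mul_apply, Finset.sum_eq_single (f a) (fun e _ he => by rw [hfz a e he, zero_mul])
      (by simp)] at this
    simpa using this
  have hinj : Function.Injective f := fun a a' haa => by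
    by_contra hne
    have := congrFun (congrFun hVV a) a'
    rw [Matrix.mul_apply, Finset.sum_eq_single (f a) (fun e _ he => by rw [hfz a e he, zero_mul])
      (by simp), Matrix.one_apply_ne hne] at this
    rcases mul_eq_zero.1 this with h1 | h1
    · exact hf a h1
    · rw [Matrix.conjTranspose_apply, star_eq_zero, haa] at h1
      exact hf a' h1
  let σ : Equiv.Perm n := (Equiv.ofBijective f (Finite.injective_iff_bijective.1 hinj)).symm
  have hfσ (a : n) : f (σ a) = a := (Equiv.ofBijective f _).apply_symm_apply a
  have hcol (a j : n) (hj : j ≠ σ a) : V j a = 0 := hfz j a fun h' => hj (by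
    refine hinj ?_
    rw [hfσ, h'])
  refine ⟨σ, fun a => conj (V (σ a) a), fun a => ?_, fun X a e => ?_⟩
  · have h1 := congrArg norm (hnorm (σ a))
    rw [hfσ, norm_mul, RCLike.norm_conj, norm_one] at h1
    rw [RCLike.norm_conj]
    nlinarith [norm_nonneg (V (σ a) a)]
  · rw [Matrix.mul_apply, Finset.sum_eq_single (σ e) (fun j _ hj => by rw [hcol e j hj, mul_zero])
      (by simp), Matrix.mul_apply, Finset.sum_eq_single (σ a) (fun j _ hj => by
        rw [Matrix.conjTranspose_apply, hcol a j hj, star_zero, zero_mul]) (by simp)]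
    simp

end

end IsCanonicalBlock

/-! ### Reduction to one block and conclusion -/

/-- A canonical form that satisfies C1 has exactly one block. -/
theorem TICanonicalForm.exists_isCanonicalBlock {d D L : ℕ} [NeZero D]
    {A : Fin d → Matrix (Fin D) (Fin D) ℂ} (h : TICanonicalForm A) (hC1 : ConditionC1 L A) :
    ∃ (b : Fin d → Matrix (Fin D) (Fin D) ℂ) (Λ : Fin D → ℝ) (r : ℝ), 0 < r ∧
      IsCanonicalBlock b Λ ∧ (∀ i, A i = (r : ℂ) • b i) ∧
      ((∀ j, Function.Injective (h.Lam j)) → Function.Injective Λ) := by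
  let e : (Σ j, Fin (h.size j)) ≃ Fin D := finSigmaFinEquiv.trans (finCongr h.sum_size)
  have hA (i) : A i = Matrix.reindexAlgEquiv ℂ ℂ e
      (Matrix.blockDiagonal' fun j => (h.lam j : ℂ) • h.block j i) := h.decomposition i
  have hoff (j j' : Fin h.numBlocks) (hj : j ≠ j') (a : Fin (h.size j)) (a' : Fin (h.size j'))
      (l : List (Fin d)) : wordProd A l (e ⟨j, a⟩) (e ⟨j', a'⟩) = 0 := by
    obtain ⟨M, hM⟩ : ∃ M : ∀ j, Matrix (Fin (h.size j)) (Fin (h.size j)) ℂ,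
        wordProd A l = Matrix.reindexAlgEquiv ℂ ℂ e (Matrix.blockDiagonal' M) := by
      induction l with
      | nil => exact ⟨1, by rw [Matrix.blockDiagonal'_one, map_one]; rfl⟩
      | cons i l ih =>
        obtain ⟨M, hM⟩ := ih
        exact ⟨_, by rw [wordProd_cons, hM, hA, ← map_mul, ← Matrix.blockDiagonal'_mul]⟩
    rw [hM]
    simp [Matrix.coe_reindexAlgEquiv, Matrix.reindex_apply,
      Matrix.blockDiagonal'_apply_ne _ _ _ hj]
  have hsub : Subsingleton (Fin h.numBlocks) := by
    refine ⟨fun j j' => ?_⟩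
    by_contra hj
    let a : Fin (h.size j) := ⟨0, h.size_pos j⟩
    let a' : Fin (h.size j') := ⟨0, h.size_pos j'⟩
    -- Words are block diagonal, so `Γ_L` kills a matrix unit linking two blocks.
    have h0 : Matrix.single (e ⟨j', a'⟩) (e ⟨j, a⟩) (1 : ℂ) = 0 := hC1 <| funext fun s => by
      simp only [gamma, word_eq_wordProd]
      rw [Matrix.trace_single_mul, hoff j j' hj]
      simp
    have := congrFun (congrFun h0 (e ⟨j', a'⟩)) (e ⟨j, a⟩)
    simp at this
  let j : Fin h.numBlocks := (e.symm 0).1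
  let u : Fin (h.size j) ≃ Σ j, Fin (h.size j) :=
    ⟨fun a => ⟨j, a⟩, fun p => (Subsingleton.elim p.1 j) ▸ p.2, fun a => rfl, fun ⟨j', a⟩ => by
      obtain rfl := Subsingleton.elim j' j
      rfl⟩
  have hblock : IsCanonicalBlock (h.block j) (h.Lam j) :=
    ⟨h.unital j, h.Lam_pos j, h.Lam_fixed j, h.fixed_unique j⟩
  refine ⟨_, _, h.lam j, h.lam_pos j, hblock.reindex (u.trans e), fun i => ?_, fun hinj =>
    (hinj j).comp (u.trans e).symm.injective⟩
  rw [hA]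
  ext x y
  obtain ⟨p, rfl⟩ := (u.trans e).surjective x
  obtain ⟨q, rfl⟩ := (u.trans e).surjective y
  rw [Matrix.smul_apply, Matrix.coe_reindexAlgEquiv ℂ ℂ (u.trans e), Matrix.reindex_apply,
    Matrix.submatrix_apply, Equiv.symm_apply_apply, Equiv.symm_apply_apply]
  change Matrix.reindexAlgEquiv ℂ ℂ e _ (e ⟨j, p⟩) (e ⟨j, q⟩) = _
  simp [Matrix.coe_reindexAlgEquiv, Matrix.reindex_apply, Matrix.blockDiagonal'_apply_eq]

end MPS

theorem MPS.wordProd_smul_conj {d D : ℕ} {B C : Fin d → Matrix (Fin D) (Fin D) ℂ}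
    {V W : Matrix (Fin D) (Fin D) ℂ} (hVW : V * W = 1) (hWV : W * V = 1) {ω : ℂ}
    (h : ∀ i, B i = ω • (W * C i * V)) (l : List (Fin d)) :
    wordProd B l = ω ^ l.length • (W * wordProd C l * V) := by
  induction l with
  | nil => simp [wordProd, hWV]
  | cons i l ih =>
    rw [wordProd_cons, wordProd_cons, ih, h, smul_mul_smul_comm, List.length_cons, pow_succ']
    congr 1
    calc W * C i * V * (W * wordProd C l * V) = W * C i * (V * W) * wordProd C l * V := by
          simp only [mul_assoc]
      _ = _ := by rw [hVW, mul_one, mul_assoc W]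

theorem theorem7 (d D N L₀ : ℕ)
    (B : Fin d → Matrix (Fin D) (Fin D) ℂ) (hB : MPS.TICanonicalForm B)
    (hC1 : MPS.ConditionC1 L₀ B)
    (hOBC : MPS.UniqueOBCCanonical (MPS.tiState N B))
    (hN : 2 * L₀ + D ^ 4 < N)
    (C : Fin d → Matrix (Fin D) (Fin D) ℂ) (hC : MPS.TICanonicalForm C)
    (hψ : MPS.tiState N B = MPS.tiState N C) :
    ∃ U ∈ Matrix.unitaryGroup (Fin D) ℂ, ∃ ω : ℂ, ω ^ N = 1 ∧
      (∀ i, B i = ω • (U * C i * Uᴴ)) ∧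
      ((∀ j, Function.Injective (hB.Lam j)) →
        ∃ (σ : Equiv.Perm (Fin D)) (θ : Fin D → ℂ), (∀ a, ‖θ a‖ = 1) ∧
          ∀ i a b, B i a b = ω * (θ a * C i (σ a) (σ b) * conj (θ b))) := by

  rcases Nat.eq_zero_or_pos D with rfl | hD
  · exact ⟨1, one_mem _, 1, one_pow _, fun i => Subsingleton.elim _ _, fun _ =>
      ⟨1, fun _ => 1, fun _ => norm_one, fun _ a => a.elim0⟩⟩
  have : NeZero D := ⟨hD.ne'⟩
  obtain ⟨b, Λ, r, hr, hb, hBb, hinj⟩ := hB.exists_isCanonicalBlock hC1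
  have hr0 : (r : ℂ) ≠ 0 := by exact_mod_cast hr.ne'
  have hunit {A a : Fin d → Matrix (Fin D) (Fin D) ℂ} {Λ : Fin D → ℝ} {r : ℝ}
      (ha : MPS.IsCanonicalBlock a Λ) (hA : ∀ i, A i = (r : ℂ) • a i) :
      ∑ i, A i * (A i)ᴴ = ((r : ℂ) * r) • 1 := by
    simp only [hA, Matrix.conjTranspose_smul, smul_mul_smul_comm]
    rw [← Finset.smul_sum, ha.unital]
    simp
  have hspan (m : ℕ) (hm : L₀ ≤ m) : MPS.WordsSpan B m :=
    hC1.wordsSpan.mono (mul_ne_zero hr0 hr0) (hunit hb hBb) hm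
  have hC1' : MPS.ConditionC1 L₀ C :=
    (MPS.WordsSpan.of_tiState_eq hψ (by omega) (hspan _ le_rfl)
      (hspan _ (by omega))).conditionC1
  obtain ⟨c, Λ', t, ht, hc, hCc, -⟩ := hC.exists_isCanonicalBlock hC1'
  have ht0 : (t : ℂ) ≠ 0 := by exact_mod_cast ht.ne'
  obtain ⟨P, Q, hPQ, hQP, x, hx, hconj⟩ := MPS.exists_conj_of_tiState_eq hψ (by omega) hspan
    (mul_ne_zero ht0 ht0) (hunit hc hCc)
  -- The factor `r / t` in `κ` converts from `B`, `C` to their normalized blocks `b`, `c`.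
  obtain ⟨hκ, V, hV, hcV⟩ := hb.exists_unitary_conj hc hPQ hQP (κ := x * r / t) fun i => by
    have h1 := hconj i
    rw [hCc, hBb, mul_smul_comm, smul_mul_assoc, smul_smul] at h1
    rw [div_eq_inv_mul, mul_smul, ← h1, inv_smul_smul₀ ht0]
  have hVV : V * Vᴴ = 1 := Matrix.mem_unitaryGroup_iff.1 hV
  have hVV' : Vᴴ * V = 1 := Matrix.mem_unitaryGroup_iff'.1 hV
  have hBC (i : Fin d) : B i = x⁻¹ • (Vᴴ * C i * V) := by
    rw [hCc, hcV, hBb, mul_smul_comm, smul_mul_assoc, mul_smul_comm, smul_mul_assoc, smul_smul,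
      smul_smul]
    have h1 : Vᴴ * (V * b i * Vᴴ) * V = b i := by
      calc Vᴴ * (V * b i * Vᴴ) * V = (Vᴴ * V) * b i * (Vᴴ * V) := by simp only [mul_assoc]
        _ = b i := by rw [hVV', one_mul, mul_one]
    rw [h1]
    congr 1
    field_simp
  -- Each trace of a word of length `N` equals `x⁻¹ ^ N` times itself; not all of these traces
  -- vanish, since the words span.
  have hω : x⁻¹ ^ N = 1 := by
    by_contra hne
    refine one_ne_zero (α := Matrix (Fin D) (Fin D) ℂ)
      (Matrix.eq_zero_of_trace_mul_span_right (hspan N (by omega)) fun l => ?_)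
    have h1 := congrArg Matrix.trace (MPS.wordProd_smul_conj hVV hVV' hBC (l : List (Fin d)))
    rw [Matrix.trace_smul, Matrix.trace_mul_comm, ← mul_assoc, hVV, one_mul, l.2,
      ← MPS.trace_wordProd_eq_of_tiState_eq hψ l.2, smul_eq_mul] at h1
    rw [one_mul]
    by_contra h0
    exact hne (mul_right_cancel₀ h0 (by rw [one_mul, ← h1]))
  refine ⟨Vᴴ, Matrix.star_eq_conjTranspose V ▸ Unitary.star_mem hV, x⁻¹, hω, fun i => ?_, fun hj => ?_⟩
  · rw [Matrix.conjTranspose_conjTranspose, hBC]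
  · obtain ⟨σ, θ, hθ, h⟩ := hb.exists_perm_of_unitary_conj hc (hinj hj) hκ hV hcV
    exact ⟨σ, θ, hθ, fun i a e => by rw [hBC, Matrix.smul_apply, h, smul_eq_mul]⟩
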